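/- Let $H$ be a complex Hilbert space and let $S,T$ be bounded linear operators on $H$. Assume that $S$ and $T$ are power bounded, i.e. $\sup_{k\ge 0}\|S^k\|<\infty$ and $\sup_{k\ge 0}\|T^k\|<\infty$, that $ST^*=T^*S$, and that for some integers $m,n\ge 1$ $$S^{*n}\,\triangle^m_{T,S}(I)\,S^n=0,$$ where $\triangle_{T,S}(X)=TXS-X$ for every bounded linear operator $X$ on $H$, so that $\triangle^m_{T,S}(I)=\sum_{j=0}^m(-1)^j\binom{m}{j}T^{m-j}S^{m-j}$. Then $S$ is polaroid: every isolated point $\lambda$ of the spectrum $\sigma(S)$ is a pole of the resolvent of $S$, in the sense that the ascent and the descent of $S-\lambda I$ are finite and equal. Here the ascent (resp. descent) of an operator $A$ is the least integer $k\ge 0$ with $\ker A^k=\ker A^{k+1}$ (resp. $A^kH=A^{k+1}H$), and is $\infty$ if there is no such $k$. -/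

import Mathlib

open ContinuousLinearMap

noncomputable section

section Operators

variable {X : Type*} [NormedAddCommGroup X] [NormedSpace ℂ X]

/-- An operator `A` is power bounded if its powers are uniformly bounded in norm. -/
def PowerBounded (A : X →L[ℂ] X) : Prop :=
  ∃ M : ℝ, ∀ k : ℕ, ‖A ^ k‖ ≤ M

/-- The elementary operator `L_T R_S - I`, acting on bounded operators by
`Y ↦ T Y S - Y`. -/
def triangleOp (T S : X →L[ℂ] X) : (X →L[ℂ] X) →L[ℂ] (X →L[ℂ] X) :=
  (ContinuousLinearMap.mul ℂ (X →L[ℂ] X) T) ∘L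
      ((ContinuousLinearMap.mul ℂ (X →L[ℂ] X)).flip S) -
    ContinuousLinearMap.id ℂ (X →L[ℂ] X)

theorem triangleOp_apply (T S Y : X →L[ℂ] X) :
    triangleOp T S Y = T * Y * S - Y := by
  simp [triangleOp, mul_assoc]

/-- The ascent of `A`: the least `k` with `ker A ^ k = ker A ^ (k + 1)`, or `⊤` if there is
no such `k`. -/
def ascent (A : X →L[ℂ] X) : ℕ∞ :=
  ⨅ (k : ℕ) (_ : {x : X | (A ^ k) x = 0} = {x : X | (A ^ (k + 1)) x = 0}), (k : ℕ∞)

/-- The descent of `A`: the least `k` with `A ^ k X = A ^ (k + 1) X`, or `⊤` if there is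
no such `k`. -/
def descent (A : X →L[ℂ] X) : ℕ∞ :=
  ⨅ (k : ℕ) (_ : Set.range (A ^ k) = Set.range (A ^ (k + 1))), (k : ℕ∞)

/-- The isolated points of the spectrum of `A`. -/
def isoSpectrum (A : X →L[ℂ] X) : Set ℂ :=
  spectrum ℂ A \ derivedSet (spectrum ℂ A)

/-- The poles (of the resolvent) of `A`: the isolated points `z` of the spectrum at which the
ascent and the descent of `A - z` are finite and equal. -/
def polesOf (A : X →L[ℂ] X) : Set ℂ :=
  {z ∈ isoSpectrum A |
    ascent (A - z • (1 : X →L[ℂ] X)) = descent (A - z • (1 : X →L[ℂ] X)) ∧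
      ascent (A - z • (1 : X →L[ℂ] X)) < ⊤}

/-- `A` is polaroid if the isolated points of its spectrum are exactly its poles. -/
def IsPolaroid (A : X →L[ℂ] X) : Prop :=
  isoSpectrum A = polesOf A

end Operators

end

/-! Since `T` commutes with `S*`, the hypothesis says that `L_T R_S - 1` is nilpotent on `Z =
S*ⁿSⁿ`. As `L_T R_S` is power bounded, it fixes `Z`, so `TᵏZSᵏ = Z` for all `k`. Pairing with `x`
gives `‖Sⁿx‖ ≤ M‖SᵏSⁿx‖` (`norm_pow_le_norm_pow_mul_pow`): orbits starting in the range of `Sⁿ` are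
bounded above and below.

Such orbits force `| |z| - 1 | ‖R(z)Sⁿ‖ ≤ K` on the resolvent set, where `R` is the resolvent. Near
an isolated point `l` of the spectrum, integrate `(|z|² - 1)R(z)Sⁿ` over small circles if `|l| = 1`,
and `R(z)Sⁿ` otherwise. With `A = S - l` and Riesz projection `P = 1 + AD`, this yields `APSⁿ = 0`.
Algebra turns it into `A^N = A^(N+1)C` with `C` commuting with `A`, which makes ascent and descent
finite and equal. Here `N = n + 1` if `l = 0` and `N = 1` otherwise. -/

/-- A Jordan chain of length two at eigenvalue 1 would make `Eᵏu = u + k(E - 1)u` grow linearly,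
against power boundedness. -/
theorem eq_of_sub_one_pow_apply_eq_zero {V : Type*} [NormedAddCommGroup V] [NormedSpace ℂ V]
    (E : V →L[ℂ] V) (K : ℝ) (hE : ∀ k : ℕ, ‖E ^ k‖ ≤ K) (m : ℕ) (v : V)
    (hv : ((E - 1) ^ m) v = 0) : E v = v := by
  have hlin : ∀ u : V, (E - 1) ((E - 1) u) = 0 → (E - 1) u = 0 := by
    intro u hu
    have hfix : E ((E - 1) u) = (E - 1) u := by
      have : E ((E - 1) u) - (E - 1) u = 0 := hu
      exact sub_eq_zero.mp this
    have hpow : ∀ k : ℕ, (E ^ k) u = u + (k : ℂ) • (E - 1) u := by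
      intro k
      induction k with
      | zero => simp
      | succ k ih =>
        rw [pow_succ', mul_apply_eq_comp, ih, map_add, map_smul, hfix]
        have : E u = u + (E - 1) u := by simp
        rw [this]
        push_cast
        module
    by_contra hne
    have hpos : 0 < ‖(E - 1) u‖ := norm_pos_iff.mpr hne
    obtain ⟨k, hk⟩ := exists_nat_gt ((K * ‖u‖ + ‖u‖) / ‖(E - 1) u‖)
    rw [div_lt_iff₀ hpos] at hk
    have h1 : (k : ℂ) • (E - 1) u = (E ^ k) u - u := by rw [hpow k]; abel
    have h2 : (k : ℝ) * ‖(E - 1) u‖ ≤ K * ‖u‖ + ‖u‖ := by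
      calc (k : ℝ) * ‖(E - 1) u‖ = ‖(k : ℂ) • (E - 1) u‖ := by rw [norm_smul]; simp
        _ = ‖(E ^ k) u - u‖ := by rw [h1]
        _ ≤ ‖(E ^ k) u‖ + ‖u‖ := norm_sub_le _ _
        _ ≤ K * ‖u‖ + ‖u‖ := by
          gcongr
          exact (E ^ k).le_of_opNorm_le (hE k) u
    linarith
  have key : ∀ m : ℕ, ((E - 1) ^ m) v = 0 → (E - 1) v = 0 := by
    intro m
    induction m with
    | zero => intro h; have h' : v = 0 := by simpa using h
              simp [h']
    | succ m ih =>
      intro h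
      cases m with
      | zero => simpa using h
      | succ m =>
        apply ih
        rw [pow_succ', mul_apply_eq_comp]
        apply hlin
        rwa [pow_succ', pow_succ'] at h
  have := key m hv
  simpa [sub_eq_zero] using this

/-! ### Lower bounds on orbits from the operator identity -/

section Hilbert

variable {H : Type*} [NormedAddCommGroup H] [InnerProductSpace ℂ H] [CompleteSpace H]

theorem mul_triangleOp_pow_mul (S T A : H →L[ℂ] H) (h : Commute T A) (n m : ℕ)
    (Y : H →L[ℂ] H) :
    A * ((triangleOp T S) ^ m) Y * S ^ n = ((triangleOp T S) ^ m) (A * Y * S ^ n) := by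
  induction m with
  | zero => simp
  | succ m ih =>
    simp only [pow_succ' (triangleOp T S), mul_apply_eq_comp, ← ih, triangleOp_apply]
    simp only [mul_sub, sub_mul, mul_assoc]
    rw [← mul_assoc A T, ← h.eq, mul_assoc, ← pow_succ, ← pow_succ']

theorem norm_pow_le_norm_pow_mul_pow (S T : H →L[ℂ] H) (m n : ℕ)
    (hS : PowerBounded S) (hT : PowerBounded T)
    (hcomm : S * adjoint T - adjoint T * S = 0)
    (hquasi : (adjoint S) ^ n * ((triangleOp T S) ^ m) (1 : H →L[ℂ] H) * S ^ n = 0) :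
    ∃ M : ℝ, (∀ k : ℕ, ‖S ^ k‖ ≤ M) ∧
      ∀ (k : ℕ) (x : H), ‖(S ^ n) x‖ ≤ M * ‖(S ^ k) ((S ^ n) x)‖ := by
  obtain ⟨M₁, h₁⟩ := hS
  obtain ⟨M₂, h₂⟩ := hT
  have hM₁ : 0 ≤ M₁ := (norm_nonneg _).trans (h₁ 0)
  have hM₂ : 0 ≤ M₂ := (norm_nonneg _).trans (h₂ 0)
  have hST : Commute S (star T) := sub_eq_zero.mp hcomm
  have hTS : Commute T (star S) := by simpa using hST.symm.star_star
  have hTSn : Commute T ((star S) ^ n) := hTS.pow_right n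
  set Z : H →L[ℂ] H := (star S) ^ n * S ^ n with hZ
  have hZ0 : ((triangleOp T S) ^ m) Z = 0 := by
    have := mul_triangleOp_pow_mul S T _ hTSn n m 1
    rw [mul_one] at this
    rw [hZ, ← this]
    exact hquasi
  set E := triangleOp T S + 1 with hE
  have hEk : ∀ (k : ℕ) (Y : H →L[ℂ] H), (E ^ k) Y = T ^ k * Y * S ^ k := by
    intro k
    induction k with
    | zero => intro Y; simp
    | succ k ih =>
      intro Y
      rw [pow_succ', mul_apply_eq_comp, ih, hE, add_apply,
        triangleOp_apply, one_apply_eq_self, sub_add_cancel, pow_succ' T, pow_succ S]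
      simp only [mul_assoc]
  have hEn : ∀ k : ℕ, ‖E ^ k‖ ≤ M₂ * M₁ := by
    intro k
    refine ContinuousLinearMap.opNorm_le_bound _ (by positivity) fun Y => ?_
    rw [hEk]
    calc ‖T ^ k * Y * S ^ k‖ ≤ ‖T ^ k‖ * ‖Y‖ * ‖S ^ k‖ :=
          (norm_mul_le _ _).trans (by gcongr; exact norm_mul_le _ _)
      _ ≤ M₂ * ‖Y‖ * M₁ := by gcongr; exacts [h₂ k, h₁ k]
      _ = M₂ * M₁ * ‖Y‖ := by ring
  have hEZ : E Z = Z :=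
    eq_of_sub_one_pow_apply_eq_zero E _ hEn m Z (by rw [hE, add_sub_cancel_right]; exact hZ0)
  have hEkZ : ∀ k : ℕ, T ^ k * Z * S ^ k = Z := by
    intro k
    rw [← hEk]
    induction k with
    | zero => simp
    | succ k ih => rw [pow_succ, mul_apply_eq_comp, hEZ, ih]
  refine ⟨max M₁ M₂, fun k => (h₁ k).trans (le_max_left _ _), fun k x => ?_⟩
  -- Moving `Tᵏ` past `S*ⁿ` leaves `S*ⁿ` outermost, so that in the inner product it passes to the
  -- other side as `Sⁿ`.
  have hid : star (S ^ n) * (T ^ k * (S ^ k * S ^ n)) = star (S ^ n) * S ^ n := by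
    have hc : Commute (T ^ k) ((star S) ^ n) := hTSn.pow_left k
    have := hEkZ k
    rw [hZ, ← mul_assoc, hc.eq] at this
    rw [star_pow]
    calc _ = star S ^ n * T ^ k * S ^ n * S ^ k := by
          simp only [mul_assoc, ← pow_add]; rw [add_comm]
      _ = _ := this
  have hin : inner ℂ ((S ^ n) x) ((S ^ n) x)
      = inner ℂ ((S ^ n) x) ((T ^ k) ((S ^ k) ((S ^ n) x))) := by
    have := congrArg (fun B : H →L[ℂ] H => inner ℂ x (B x)) hid
    simp only [mul_apply_eq_comp, ContinuousLinearMap.star_eq_adjoint,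
      ContinuousLinearMap.adjoint_inner_right] at this
    exact this.symm
  have hsq : ‖(S ^ n) x‖ * ‖(S ^ n) x‖ ≤
      ‖(S ^ n) x‖ * (max M₁ M₂ * ‖(S ^ k) ((S ^ n) x)‖) := by
    calc ‖(S ^ n) x‖ * ‖(S ^ n) x‖ = ‖inner ℂ ((S ^ n) x) ((S ^ n) x)‖ := by
          rw [inner_self_eq_norm_sq_to_K]; simp [sq]
      _ ≤ ‖(S ^ n) x‖ * ‖(T ^ k) ((S ^ k) ((S ^ n) x))‖ := by
          rw [hin]; exact norm_inner_le_norm _ _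
      _ ≤ _ := by
          gcongr
          exact (T ^ k).le_of_opNorm_le ((h₂ k).trans (le_max_right _ _)) _
  rcases (norm_nonneg ((S ^ n) x)).eq_or_lt with h0 | h0
  · rw [← h0]; positivity
  · exact le_of_mul_le_mul_left hsq h0

end Hilbert

/-! ### Estimates for `z - S` off the unit circle -/

section LowerBound

variable {X : Type*} [NormedAddCommGroup X] [NormedSpace ℂ X]

/-- An operator whose powers are uniformly bounded, and bounded below on the orbit of `y`,
behaves like an isometry away from the unit circle. -/
theorem abs_norm_sub_one_mul_norm_le (S : X →L[ℂ] X) (M : ℝ) (hM : ∀ k : ℕ, ‖S ^ k‖ ≤ M)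
    (y : X) (hy : ∀ k : ℕ, ‖y‖ ≤ M * ‖(S ^ k) y‖) (z : ℂ) :
    |‖z‖ - 1| * ‖y‖ ≤ (M + M ^ 2) * ‖z • y - S y‖ := by
  have hM0 : 0 ≤ M := (norm_nonneg _).trans (hM 0)
  set v := z • y - S y with hv
  have hexp : ∀ k : ℕ, z ^ k • y - (S ^ k) y
      = ∑ i ∈ Finset.range k, z ^ i • (S ^ (k - 1 - i)) v := by
    intro k
    have h := (Commute.one_left S).smul_left z |>.geom_sum₂_mul k
    have h' := congrArg (fun B : X →L[ℂ] X => B y) h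
    simpa [sum_apply, smul_pow, hv] using h'.symm
  have hbd : ∀ k : ℕ, ‖z ^ k • y - (S ^ k) y‖ ≤ (∑ i ∈ Finset.range k, ‖z‖ ^ i) * (M * ‖v‖) := by
    intro k
    rw [hexp, Finset.sum_mul]
    refine (norm_sum_le _ _).trans (Finset.sum_le_sum fun i _ => ?_)
    rw [norm_smul, norm_pow]
    gcongr
    exact (S ^ _).le_of_opNorm_le (hM _) v
  rcases lt_trichotomy ‖z‖ 1 with h | h | h
  -- Inside the disc `zᵏy` dies out, so the lower bound on `Sᵏy` must be absorbed by the geometric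
  -- sum in `v`.
  · have hlim : Filter.Tendsto (fun k : ℕ => M * ‖z‖ ^ k * ((1 - ‖z‖) * ‖y‖) + M ^ 2 * ‖v‖)
        Filter.atTop (nhds (M * 0 * ((1 - ‖z‖) * ‖y‖) + M ^ 2 * ‖v‖)) :=
      (((tendsto_pow_atTop_nhds_zero_of_lt_one (norm_nonneg z) h).const_mul M).mul_const
        _).add_const _
    have hle : (1 - ‖z‖) * ‖y‖ ≤ M ^ 2 * ‖v‖ := by
      have := ge_of_tendsto' hlim (b := (1 - ‖z‖) * ‖y‖) fun k => ?_
      · simpa using this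
      have h1 : ‖(S ^ k) y‖ ≤ ‖z‖ ^ k * ‖y‖ + (∑ i ∈ Finset.range k, ‖z‖ ^ i) * (M * ‖v‖) := by
        have := norm_sub_le (z ^ k • y) (z ^ k • y - (S ^ k) y)
        rw [sub_sub_cancel, norm_smul, norm_pow] at this
        linarith [hbd k]
      have h2 : (1 - ‖z‖) * ∑ i ∈ Finset.range k, ‖z‖ ^ i ≤ 1 := by
        rw [mul_neg_geom_sum]
        linarith [pow_nonneg (norm_nonneg z) k]
      have h3 : ‖y‖ ≤ M * (‖z‖ ^ k * ‖y‖ + (∑ i ∈ Finset.range k, ‖z‖ ^ i) * (M * ‖v‖)) :=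
        (hy k).trans (by gcongr)
      have h4 := mul_le_mul_of_nonneg_left h3 (sub_nonneg.mpr h.le)
      have h5 : 0 ≤ M * (M * ‖v‖) := by positivity
      nlinarith [mul_le_mul_of_nonneg_right h2 h5]
    rw [abs_of_neg (by linarith), neg_sub]
    nlinarith [norm_nonneg v, mul_nonneg hM0 (norm_nonneg v)]
  · rw [h]; simp; positivity
  -- Outside the disc `zᵏy` dominates: power boundedness alone suffices, after division by `‖z‖ ^
  -- k`.
  · have hz0 : 0 < ‖z‖ := by linarith
    have hlim : Filter.Tendsto
        (fun k : ℕ => (‖z‖⁻¹) ^ k * ((‖z‖ - 1) * (M * ‖y‖)) + M * ‖v‖)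
        Filter.atTop (nhds (0 * ((‖z‖ - 1) * (M * ‖y‖)) + M * ‖v‖)) :=
      ((tendsto_pow_atTop_nhds_zero_of_lt_one (by positivity) (inv_lt_one_of_one_lt₀ h)).mul_const
        _).add_const _
    have hle : (‖z‖ - 1) * ‖y‖ ≤ M * ‖v‖ := by
      have := ge_of_tendsto' hlim (b := (‖z‖ - 1) * ‖y‖) fun k => ?_
      · simpa using this
      have h1 : ‖z‖ ^ k * ‖y‖ ≤ M * ‖y‖ + (∑ i ∈ Finset.range k, ‖z‖ ^ i) * (M * ‖v‖) := by
        have := norm_add_le ((S ^ k) y) (z ^ k • y - (S ^ k) y)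
        rw [add_sub_cancel, norm_smul, norm_pow] at this
        linarith [hbd k, (S ^ k).le_of_opNorm_le (hM k) y]
      have h2 : (‖z‖ - 1) * ∑ i ∈ Finset.range k, ‖z‖ ^ i ≤ ‖z‖ ^ k := by
        rw [mul_geom_sum]
        linarith
      have hp : 0 < ‖z‖ ^ k := by positivity
      have h4 := mul_le_mul_of_nonneg_left h1 (sub_nonneg.mpr h.le)
      have h5 : 0 ≤ M * ‖v‖ := by positivity
      have h6 := mul_le_mul_of_nonneg_right h2 h5
      have h7 : ‖z‖ ^ k * ((‖z‖ - 1) * ‖y‖)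
          ≤ ‖z‖ ^ k * ((‖z‖⁻¹) ^ k * ((‖z‖ - 1) * (M * ‖y‖)) + M * ‖v‖) := by
        rw [mul_add, ← mul_assoc (‖z‖ ^ k) (‖z‖⁻¹ ^ k), ← mul_pow, mul_inv_cancel₀ hz0.ne',
          one_pow]
        linarith
      exact le_of_mul_le_mul_left h7 hp
    rw [abs_of_pos (by linarith)]
    nlinarith [norm_nonneg v]

end LowerBound

/-! ### An algebraic criterion for finite, equal ascent and descent -/

section AscentDescent

variable {X : Type*} [NormedAddCommGroup X] [NormedSpace ℂ X]

/-- If `A ^ N = A ^ (N + 1) * C` with `C` commuting with `A`, then ascent and descent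
of `A` are finite and equal. -/
theorem ascent_eq_descent_of_pow_eq (A C : X →L[ℂ] X) (hAC : Commute A C) (N : ℕ)
    (h : A ^ N = A ^ (N + 1) * C) : ascent A = descent A ∧ ascent A < ⊤ := by
  have fwd : ∀ k, A ^ k = A ^ (k + 1) * C →
      {x : X | (A ^ k) x = 0} = {x : X | (A ^ (k + 1)) x = 0} ∧
        Set.range ⇑(A ^ k) = Set.range ⇑(A ^ (k + 1)) := by
    intro k hk
    have hk' : A ^ k = C * A ^ (k + 1) := by rw [hk]; exact (hAC.pow_left _).eq
    refine ⟨Set.ext fun x => ⟨fun hx => ?_, fun hx => ?_⟩, Set.Subset.antisymm ?_ ?_⟩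
    · have hx : (A ^ k) x = 0 := hx
      show (A ^ (k + 1)) x = 0
      rw [pow_succ', mul_apply_eq_comp, hx, map_zero]
    · have hx : (A ^ (k + 1)) x = 0 := hx
      show (A ^ k) x = 0
      rw [hk', mul_apply_eq_comp, hx, map_zero]
    · rintro _ ⟨x, rfl⟩
      exact ⟨C x, by rw [← mul_apply_eq_comp, ← hk]⟩
    · rintro _ ⟨x, rfl⟩
      exact ⟨A x, by rw [pow_succ, mul_apply_eq_comp]⟩
  have up : ∀ j k, A ^ k = A ^ (k + 1) * C → A ^ (k + j) = A ^ (k + j + 1) * C := by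
    intro j k hk
    rw [add_right_comm, pow_add, pow_add, hk, mul_assoc, mul_assoc, (hAC.symm.pow_right j).eq]
  have ker_imp : ∀ k, {x : X | (A ^ k) x = 0} = {x : X | (A ^ (k + 1)) x = 0} →
      A ^ k = A ^ (k + 1) * C := by
    intro k hk
    have hker : ∀ j x, (A ^ (k + j)) x = 0 → (A ^ k) x = 0 := by
      intro j
      induction j with
      | zero => intro x hx; exact hx
      | succ j ih =>
        intro x hx
        apply ih
        have h1 : (A ^ (k + 1)) ((A ^ j) x) = 0 := by
          rw [← mul_apply_eq_comp, ← pow_add, add_right_comm]; exact hx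
        have h2 : (A ^ k) ((A ^ j) x) = 0 := by
          change (A ^ j) x ∈ {x : X | (A ^ k) x = 0}
          rw [hk]; exact h1
        rw [pow_add, mul_apply_eq_comp]; exact h2
    ext x
    have h0 : (A ^ (k + N)) (x - A (C x)) = 0 := by
      have := congrArg (fun B : X →L[ℂ] X => B x) (up k N h)
      simp only [pow_succ, mul_apply_eq_comp] at this
      rw [map_sub, sub_eq_zero, add_comm]
      exact this
    have h1 := hker N _ h0
    rw [map_sub, sub_eq_zero] at h1
    rw [h1, pow_succ]; rfl
  have ran_imp : ∀ k, Set.range ⇑(A ^ k) = Set.range ⇑(A ^ (k + 1)) →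
      {x : X | (A ^ k) x = 0} = {x : X | (A ^ (k + 1)) x = 0} := by
    intro k hk
    have hran : ∀ j x, ∃ y, (A ^ k) x = (A ^ (k + j)) y := by
      intro j
      induction j with
      | zero => intro x; exact ⟨x, rfl⟩
      | succ j ih =>
        intro x
        obtain ⟨y, hy⟩ := ih x
        have : (A ^ k) y ∈ Set.range ⇑(A ^ (k + 1)) := hk ▸ ⟨y, rfl⟩
        obtain ⟨w, hw⟩ := this
        refine ⟨w, ?_⟩
        rw [hy, add_comm k j, pow_add, mul_apply_eq_comp, ← hw,
          ← mul_apply_eq_comp, ← pow_add]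
        congr 2; ring
    refine Set.Subset.antisymm (fun x hx => ?_) (fun x hx => ?_)
    · have hx : (A ^ k) x = 0 := hx
      show (A ^ (k + 1)) x = 0
      rw [pow_succ', mul_apply_eq_comp, hx, map_zero]
    · have hx : (A ^ (k + 1)) x = 0 := hx
      show (A ^ k) x = 0
      obtain ⟨y, hy⟩ := hran N x
      have hN := (fwd (N + k) (up k N h)).1
      rw [hy, add_comm k N]
      change y ∈ {x : X | (A ^ (N + k)) x = 0}
      rw [hN]
      show (A ^ (N + k + 1)) y = 0
      rw [pow_succ', mul_apply_eq_comp, add_comm N k, ← hy,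
        ← mul_apply_eq_comp, ← pow_succ', hx]
  -- Kernels and ranges stabilise at the same indices, so the two infima run over the same set.
  have hiff : ∀ k, {x : X | (A ^ k) x = 0} = {x : X | (A ^ (k + 1)) x = 0} ↔
      Set.range ⇑(A ^ k) = Set.range ⇑(A ^ (k + 1)) :=
    fun k => ⟨fun hk => (fwd k (ker_imp k hk)).2, ran_imp k⟩
  refine ⟨?_, ?_⟩
  · unfold ascent descent
    simp only [hiff]
  · exact (iInf₂_le N (fwd N h).1).trans_lt (ENat.natCast_lt_top N)

end AscentDescent

/-! ### Laurent coefficients of the resolvent -/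

section Contour

open Metric Complex

variable {𝓐 : Type*} [NormedRing 𝓐] [NormedAlgebra ℂ 𝓐] [CompleteSpace 𝓐]

omit [CompleteSpace 𝓐] in
theorem exists_punctured_ball_subset_resolventSet (a : 𝓐) (l : ℂ)
    (h : ¬ AccPt l (Filter.principal (spectrum ℂ a))) :
    ∃ ρ > 0, ∀ z, z ≠ l → ‖z - l‖ < ρ → z ∈ resolventSet ℂ a := by
  rw [accPt_iff_frequently, Filter.not_frequently, Metric.eventually_nhds_iff] at h
  obtain ⟨ρ, hρ, h⟩ := h
  refine ⟨ρ, hρ, fun z hz hzl => ?_⟩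
  have := h (y := z) (by rwa [dist_eq_norm])
  by_contra hn
  exact this ⟨hz, hn⟩

theorem continuousLinearMap_circleIntegral_comm {E F : Type*} [NormedAddCommGroup E]
    [NormedSpace ℂ E] [CompleteSpace E] [NormedAddCommGroup F] [NormedSpace ℂ F] [CompleteSpace F]
    (L : E →L[ℂ] F) {f : ℂ → E} {c : ℂ} {r : ℝ} (hf : CircleIntegrable f c r) :
    L (∮ z in C(c, r), f z) = ∮ z in C(c, r), L (f z) := by
  simp only [circleIntegral]
  rw [← L.intervalIntegral_comp_comm hf.out]
  simp only [map_smul]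

/-- Laurent coefficients of the resolvent of `a` at an isolated point `l` of the spectrum. -/
theorem exists_circleIntegral_resolvent_eq (a : 𝓐) (l : ℂ) (ρ : ℝ) (hρ : 0 < ρ)
    (h : ∀ z, z ≠ l → ‖z - l‖ < ρ → z ∈ resolventSet ℂ a) :
    ∃ D : 𝓐, Commute a D ∧ ∀ r : ℝ, 0 < r → r < ρ → ∀ (α β γ : ℂ) (B : 𝓐),
      (∮ z in C(l, r), (α * (z - l) + β + γ * (z - l)⁻¹) • (resolvent a z * B)) =
        (2 * Real.pi * I : ℂ) •
          ((α • ((a - algebraMap ℂ 𝓐 l) * (1 + (a - algebraMap ℂ 𝓐 l) * D)) +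
            β • (1 + (a - algebraMap ℂ 𝓐 l) * D) + γ • D) * B) := by
  set b := a - algebraMap ℂ 𝓐 l with hb
  have hdiff : ∀ z, z ≠ l → ‖z - l‖ < ρ → DifferentiableAt ℂ (resolvent a) z := fun z hz hzl =>
    (spectrum.hasDerivAt_resolvent_const_left (h z hz hzl)).differentiableAt
  have hdiff' : ∀ z, z ≠ l → ‖z - l‖ < ρ →
      DifferentiableAt ℂ (fun z => (z - l)⁻¹ • resolvent a z) z := fun z hz hzl =>
    ((differentiableAt_id.sub_const l).inv (sub_ne_zero.mpr hz)).smul (hdiff z hz hzl)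
  have hsph : ∀ {r : ℝ}, 0 < r → r < ρ → ∀ z ∈ sphere l r, z ≠ l ∧ ‖z - l‖ < ρ := by
    intro r h0 hr z hz
    rw [mem_sphere_iff_norm] at hz
    exact ⟨fun he => by rw [he, sub_self, norm_zero] at hz; linarith, by rwa [hz]⟩
  have hint : ∀ r : ℝ, 0 < r → r < ρ → ∀ g : ℂ → ℂ, ContinuousOn g (sphere l r) →
      CircleIntegrable (fun z => g z • resolvent a z) l r := fun r h0 hr g hg =>
    (hg.smul fun z hz => (hdiff z (hsph h0 hr z hz).1
      (hsph h0 hr z hz).2).continuousAt.continuousWithinAt).circleIntegrable h0.le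
  have hinv : ∀ r : ℝ, 0 < r → ContinuousOn (fun z : ℂ => (z - l)⁻¹) (sphere l r) := by
    intro r h0
    refine ContinuousOn.inv₀ (by fun_prop) fun z hz => sub_ne_zero.mpr ?_
    rintro rfl
    rw [mem_sphere_iff_norm, sub_self, norm_zero] at hz
    linarith
  have hpi : (2 * Real.pi * I : ℂ) ≠ 0 := Complex.two_pi_I_ne_zero
  -- `D` is the coefficient of `(z - l)⁰`. The radius `ρ / 2` is immaterial by Cauchy's theorem on
  -- annuli.
  set D : 𝓐 := (2 * Real.pi * I : ℂ)⁻¹ • ∮ z in C(l, ρ / 2), (z - l)⁻¹ • resolvent a z with hD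
  have hDr : ∀ r : ℝ, 0 < r → r < ρ →
      (∮ z in C(l, r), (z - l)⁻¹ • resolvent a z) = (2 * Real.pi * I : ℂ) • D := by
    have aux : ∀ r R : ℝ, 0 < r → r ≤ R → R < ρ →
        (∮ z in C(l, R), (z - l)⁻¹ • resolvent a z) =
          ∮ z in C(l, r), (z - l)⁻¹ • resolvent a z := by
      intro r R h0 hrR hR
      refine circleIntegral_eq_of_differentiable_on_annulus_off_countable h0 hrR
        Set.countable_empty (fun z hz => ?_) fun z hz => ?_
      · have h1 : ‖z - l‖ ≤ R := by simpa [dist_eq_norm] using hz.1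
        refine (hdiff' z ?_ (h1.trans_lt hR)).continuousAt.continuousWithinAt
        rintro rfl
        exact hz.2 (mem_ball_self h0)
      · have h1 : ‖z - l‖ < R := by simpa [dist_eq_norm] using hz.1.1
        refine hdiff' z ?_ (h1.trans hR)
        rintro rfl
        exact hz.1.2 (mem_closedBall_self h0.le)
    intro r h0 hr
    rw [hD, smul_inv_smul₀ hpi]
    rcases le_total r (ρ / 2) with hle | hle
    · exact (aux _ _ h0 hle (by linarith)).symm
    · exact aux _ _ (by linarith) hle hr
  -- This relation gives the coefficients of `(z - l)⁻¹` and `(z - l)⁻²` from `D` by successive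
  -- multiplication by `b`.
  have hbR : ∀ r : ℝ, 0 < r → r < ρ → ∀ z ∈ sphere l r,
      b * resolvent a z = (z - l) • resolvent a z - 1 := by
    intro r h0 hr z hz
    have h1 : (algebraMap ℂ 𝓐 z - a) * resolvent a z = 1 :=
      Ring.mul_inverse_cancel _ (h z (hsph h0 hr z hz).1 (hsph h0 hr z hz).2)
    rw [← h1, Algebra.smul_def, hb, map_sub, ← sub_mul]
    congr 1
    abel
  have hcommR : ∀ z, Commute a (resolvent a z) := fun z =>
by
    by_cases hz : IsUnit (algebraMap ℂ 𝓐 z - a)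
    · obtain ⟨u, hu⟩ := hz
      rw [resolvent, ← hu, Ring.inverse_unit]
      refine Commute.units_inv_right ?_
      rw [hu]
      exact Commute.sub_right (Algebra.commutes z a).symm (Commute.refl a)
    · rw [resolvent, Ring.inverse_non_unit _ hz]
      exact Commute.zero_right a
  have hP : ∀ r : ℝ, 0 < r → r < ρ →
      (∮ z in C(l, r), resolvent a z) = (2 * Real.pi * I : ℂ) • (1 + b * D) := by
    intro r h0 hr
    have h1 := continuousLinearMap_circleIntegral_comm (ContinuousLinearMap.mul ℂ 𝓐 b)
      (hint r h0 hr _ (hinv r h0))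
    rw [hDr r h0 hr] at h1
    have h2 : (∮ z in C(l, r), ContinuousLinearMap.mul ℂ 𝓐 b ((z - l)⁻¹ • resolvent a z)) =
        ∮ z in C(l, r), (resolvent a z - (z - l)⁻¹ • (1 : 𝓐)) := by
      refine circleIntegral.integral_congr h0.le fun z hz => ?_
      have hz0 : z - l ≠ 0 := sub_ne_zero.mpr (hsph h0 hr z hz).1
      simp only [ContinuousLinearMap.mul_apply', mul_smul_comm]
      rw [hbR r h0 hr z hz, smul_sub, inv_smul_smul₀ hz0]
    have i1 : CircleIntegrable (resolvent a) l r := by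
      simpa using hint r h0 hr (fun _ => 1) continuousOn_const
    have i2 : CircleIntegrable (fun z : ℂ => (z - l)⁻¹ • (1 : 𝓐)) l r :=
      ContinuousOn.circleIntegrable h0.le ((hinv r h0).smul continuousOn_const)
    rw [h2, circleIntegral.integral_sub i1 i2,
      circleIntegral.integral_smul_const, circleIntegral.integral_sub_center_inv _ h0.ne'] at h1
    simp only [ContinuousLinearMap.mul_apply', mul_smul_comm] at h1
    rw [smul_add, h1]
    abel
  have hbP : ∀ r : ℝ, 0 < r → r < ρ →
      (∮ z in C(l, r), (z - l) • resolvent a z) =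
        (2 * Real.pi * I : ℂ) • (b * (1 + b * D)) := by
    intro r h0 hr
    have h1 := continuousLinearMap_circleIntegral_comm (ContinuousLinearMap.mul ℂ 𝓐 b)
      (by simpa using hint r h0 hr (fun _ => 1) continuousOn_const)
    rw [hP r h0 hr] at h1
    have h2 : (∮ z in C(l, r), ContinuousLinearMap.mul ℂ 𝓐 b (resolvent a z)) =
        ∮ z in C(l, r), ((z - l) • resolvent a z - (1 : 𝓐)) :=
      circleIntegral.integral_congr h0.le fun z hz => hbR r h0 hr z hz
    have h3 : (∮ _ in C(l, r), (1 : 𝓐)) = 0 :=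
      circleIntegral.integral_eq_zero_of_hasDerivWithinAt (f := fun z => z • (1 : 𝓐)) h0.le
        fun z _ => by simpa using ((hasDerivAt_id z).smul_const (1 : 𝓐)).hasDerivWithinAt
    rw [h2, circleIntegral.integral_sub (hint r h0 hr _ (by fun_prop))
      (circleIntegrable_const _ _ _), h3, sub_zero] at h1
    rw [← h1, ContinuousLinearMap.mul_apply', mul_smul_comm]
  refine ⟨D, ?_, fun r h0 hr α β γ B => ?_⟩
  · have hi := hint (ρ / 2) (by linarith) (by linarith) _ (hinv (ρ / 2) (by linarith))
    have h1 := continuousLinearMap_circleIntegral_comm (ContinuousLinearMap.mul ℂ 𝓐 a) hi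
    have h2 := continuousLinearMap_circleIntegral_comm ((ContinuousLinearMap.mul ℂ 𝓐).flip a) hi
    simp only [ContinuousLinearMap.mul_apply', ContinuousLinearMap.flip_apply, mul_smul_comm,
      smul_mul_assoc, (hcommR _).eq] at h1 h2
    rw [hD]
    exact Commute.smul_right (h1.trans h2.symm) _
  · have hB := continuousLinearMap_circleIntegral_comm ((ContinuousLinearMap.mul ℂ 𝓐).flip B)
      (hint r h0 hr (fun z => α * (z - l) + β + γ * (z - l)⁻¹)
        (((by fun_prop : Continuous fun z : ℂ => α * (z - l) + β).continuousOn).add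
          (continuousOn_const.mul (hinv r h0))))
    simp only [ContinuousLinearMap.mul_apply', ContinuousLinearMap.flip_apply,
      smul_mul_assoc] at hB
    rw [← hB, ← smul_mul_assoc]
    congr 1
    simp only [add_smul, mul_smul α, mul_smul γ]
    have i1 : CircleIntegrable (fun z => α • (z - l) • resolvent a z) l r :=
      by simpa only [mul_smul] using hint r h0 hr (fun z => α * (z - l)) (by fun_prop)
    have i2 : CircleIntegrable (fun z => β • resolvent a z) l r :=
      hint r h0 hr (fun _ => β) continuousOn_const
    have i3 : CircleIntegrable (fun z => γ • (z - l)⁻¹ • resolvent a z) l r :=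
      by simpa only [mul_smul] using
        hint r h0 hr (fun z => γ * (z - l)⁻¹) (continuousOn_const.mul (hinv r h0))
    have i12 : CircleIntegrable
        (fun z => α • (z - l) • resolvent a z + β • resolvent a z) l r := i1.add i2
    rw [circleIntegral.integral_add i12 i3, circleIntegral.integral_add i1 i2]
    simp only [circleIntegral.integral_smul]
    rw [hP r h0 hr, hbP r h0 hr, hDr r h0 hr]
    module

end Contour

/-! ### Order of the pole at an isolated spectral point -/

section Polaroid

variable {X : Type*} [NormedAddCommGroup X] [NormedSpace ℂ X] [CompleteSpace X]

theorem eq_zero_of_forall_small_norm_le {E : Type*} [NormedAddCommGroup E] [NormedSpace ℂ E]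
    (u v : E) (ρ K : ℝ) (hρ : 0 < ρ)
    (h : ∀ r : ℝ, 0 < r → r < ρ → ‖u + ((r ^ 2 : ℝ) : ℂ) • v‖ ≤ r * K) : u = 0 := by
  have hlim : Filter.Tendsto (fun r : ℝ => r * K + r ^ 2 * ‖v‖)
      (nhdsWithin 0 (Set.Ioi 0)) (nhds (0 * K + 0 ^ 2 * ‖v‖)) :=
    (Continuous.tendsto (by fun_prop) 0).mono_left nhdsWithin_le_nhds
  have hle : ‖u‖ ≤ 0 * K + 0 ^ 2 * ‖v‖ := by
    refine ge_of_tendsto hlim ?_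
    filter_upwards [Ioo_mem_nhdsGT hρ] with r hr
    have h1 := norm_sub_le (u + ((r ^ 2 : ℝ) : ℂ) • v) (((r ^ 2 : ℝ) : ℂ) • v)
    rw [add_sub_cancel_right, norm_smul ((r ^ 2 : ℝ) : ℂ), Complex.norm_real,
      Real.norm_of_nonneg (sq_nonneg r)] at h1
    linarith [h r hr.1 hr.2]
  simpa using hle

omit [CompleteSpace X] in
-- The vector `y = R(z)Sⁿx = SⁿR(z)x` lies in the range of `Sⁿ`, so the orbit estimate applies, and
-- `(z - S)y = Sⁿx`.
theorem abs_norm_sub_one_mul_norm_resolvent_mul_pow_le (S : X →L[ℂ] X) (M : ℝ) (n : ℕ)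
    (hM : ∀ k : ℕ, ‖S ^ k‖ ≤ M)
    (hlow : ∀ (k : ℕ) (x : X), ‖(S ^ n) x‖ ≤ M * ‖(S ^ k) ((S ^ n) x)‖) (z : ℂ)
    (hz : z ∈ resolventSet ℂ S) :
    |‖z‖ - 1| * ‖resolvent S z * S ^ n‖ ≤ (M + M ^ 2) * M := by
  have hM0 : 0 ≤ M := (norm_nonneg _).trans (hM 0)
  have hleft : (algebraMap ℂ (X →L[ℂ] X) z - S) * resolvent S z = 1 :=
    Ring.mul_inverse_cancel _ hz
  have hright : resolvent S z * (algebraMap ℂ (X →L[ℂ] X) z - S) = 1 :=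
    Ring.inverse_mul_cancel _ hz
  have hc : Commute (algebraMap ℂ (X →L[ℂ] X) z - S) (S ^ n) :=
    Commute.sub_left (Algebra.commutes z _) ((Commute.refl S).pow_right n)
  have hcomm : resolvent S z * S ^ n = S ^ n * resolvent S z := by
    calc resolvent S z * S ^ n
        = resolvent S z * (S ^ n * (algebraMap ℂ (X →L[ℂ] X) z - S)) * resolvent S z := by
          rw [mul_assoc, mul_assoc, hleft, mul_one]
      _ = S ^ n * resolvent S z := by
          rw [← hc.eq, ← mul_assoc, hright, one_mul]
  have habs : |‖z‖ - 1| * ‖resolvent S z * S ^ n‖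
      = ‖((|‖z‖ - 1| : ℝ) : ℂ) • (resolvent S z * S ^ n)‖ := by
    rw [norm_smul, Complex.norm_real, Real.norm_of_nonneg (abs_nonneg _)]
  rw [habs]
  refine ContinuousLinearMap.opNorm_le_bound _ (by positivity) fun x => ?_
  rw [smul_apply, norm_smul, Complex.norm_real, Real.norm_of_nonneg (abs_nonneg _)]
  have hy := abs_norm_sub_one_mul_norm_le S M hM ((resolvent S z * S ^ n) x)
    (fun k => by rw [hcomm]; exact hlow k _) z
  have hv : z • (resolvent S z * S ^ n) x - S ((resolvent S z * S ^ n) x) = (S ^ n) x := by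
    have := congrArg (fun B : X →L[ℂ] X => B ((S ^ n) x)) hleft
    simpa [Algebra.algebraMap_eq_smul_one] using this
  rw [hv] at hy
  refine hy.trans ?_
  rw [mul_assoc]
  gcongr
  exact (S ^ n).le_of_opNorm_le (hM n) x

/-- On the circle the conjugate of `z - l` is `r²/(z - l)`. The non-holomorphic weight `|z|² - 1`
thus becomes a Laurent polynomial, which can be integrated against the resolvent. -/
theorem norm_sq_sub_one_eq_of_mem_sphere (l z : ℂ) (r : ℝ) (hr : 0 < r) (hz : ‖z - l‖ = r) :
    (starRingEnd ℂ l) * (z - l) + (((‖l‖ ^ 2 - 1 : ℝ) : ℂ) + ((r ^ 2 : ℝ) : ℂ))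
      + l * ((r ^ 2 : ℝ) : ℂ) * (z - l)⁻¹ = ((‖z‖ ^ 2 - 1 : ℝ) : ℂ) := by
  have hw : z - l ≠ 0 := by rw [← norm_pos_iff, hz]; exact hr
  have h1 : ((r ^ 2 : ℝ) : ℂ) = (z - l) * starRingEnd ℂ (z - l) := by
    rw [Complex.mul_conj, Complex.normSq_eq_norm_sq, hz]
  have h2 : ((‖l‖ ^ 2 : ℝ) : ℂ) = l * starRingEnd ℂ l := by
    rw [Complex.mul_conj, Complex.normSq_eq_norm_sq]
  have h3 : ((‖z‖ ^ 2 : ℝ) : ℂ) = z * starRingEnd ℂ z := by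
    rw [Complex.mul_conj, Complex.normSq_eq_norm_sq]
  rw [Complex.ofReal_sub, Complex.ofReal_sub, h1, h2, h3, map_sub]
  field_simp
  push_cast
  ring

/-- A power bounded operator that is bounded below along the orbits of the range of one of its
powers has only poles as isolated spectral points. -/
theorem isPolaroid_of_norm_pow_le (S : X →L[ℂ] X) (M : ℝ) (n : ℕ) (hM : ∀ k : ℕ, ‖S ^ k‖ ≤ M)
    (hlow : ∀ (k : ℕ) (x : X), ‖(S ^ n) x‖ ≤ M * ‖(S ^ k) ((S ^ n) x)‖) : IsPolaroid S := by
  refine Set.Subset.antisymm (fun l hl => ⟨hl, ?_⟩) fun l hl => hl.1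
  obtain ⟨ρ, hρ, hres⟩ := exists_punctured_ball_subset_resolventSet S l hl.2
  obtain ⟨D, hSD, hD⟩ := exists_circleIntegral_resolvent_eq S l ρ hρ hres
  rw [Algebra.algebraMap_eq_smul_one] at hD
  set A := S - l • (1 : X →L[ℂ] X) with hA
  have hM0 : 0 ≤ M := (norm_nonneg _).trans (hM 0)
  have hAD : Commute A D := hSD.sub_left ((Commute.one_left D).smul_left l)
  have hAS : Commute A S := (Commute.refl S).sub_left ((Commute.one_left S).smul_left l)
  set K := (M + M ^ 2) * M with hK
  have hbound : ∀ z ∈ resolventSet ℂ S, |‖z‖ - 1| * ‖resolvent S z * S ^ n‖ ≤ K :=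
    abs_norm_sub_one_mul_norm_resolvent_mul_pow_le S M n hM hlow
  have hK0 : 0 ≤ K := by positivity
  have hest : ∀ (r C : ℝ), 0 < r → r < ρ → ∀ α β γ : ℂ,
      (∀ z, ‖z - l‖ = r → z ∈ resolventSet ℂ S →
        ‖α * (z - l) + β + γ * (z - l)⁻¹‖ * ‖resolvent S z * S ^ n‖ ≤ C) →
      ‖(α • (A * (1 + A * D)) + β • (1 + A * D) + γ • D) * S ^ n‖ ≤ r * C := by
    intro r C h0 hr α β γ hC
    have h1 := circleIntegral.norm_two_pi_i_inv_smul_integral_le_of_norm_le_const (C := C) h0.le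
      (f := fun z => (α * (z - l) + β + γ * (z - l)⁻¹) • (resolvent S z * S ^ n)) fun z hz => by
        rw [mem_sphere_iff_norm] at hz
        rw [norm_smul]
        refine hC z hz (hres z ?_ (hz ▸ hr))
        rintro rfl
        rw [sub_self, norm_zero] at hz
        exact h0.ne hz
    rwa [hD r h0 hr, inv_smul_smul₀ Complex.two_pi_I_ne_zero] at h1
  have hAPS : A * (1 + A * D) * S ^ n = 0 := by
    by_cases hl1 : ‖l‖ = 1
    -- For `|l| = 1` every term but the leading one carries `r²`, while the integral is `O(r)`; let
    -- `r → 0`. The 3 bounds `‖z‖ + 1` for `r < 1`.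
    · have h0 : (starRingEnd ℂ l) • (A * (1 + A * D) * S ^ n) = 0 := by
        refine eq_zero_of_forall_small_norm_le _ ((1 + A * D + l • D) * S ^ n) (min ρ 1)
          (K * 3) (lt_min hρ one_pos) fun r h0 hr => ?_
        have h1 := hest r (K * 3) h0 (hr.trans_le (min_le_left _ _)) (starRingEnd ℂ l)
          (((‖l‖ ^ 2 - 1 : ℝ) : ℂ) + ((r ^ 2 : ℝ) : ℂ)) (l * ((r ^ 2 : ℝ) : ℂ)) fun z hz hzr => by
            rw [norm_sq_sub_one_eq_of_mem_sphere l z r h0 hz, Complex.norm_real, Real.norm_eq_abs]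
            have h2 : |‖z‖ ^ 2 - 1| = |‖z‖ - 1| * (‖z‖ + 1) := by
              rw [show ‖z‖ ^ 2 - 1 = (‖z‖ - 1) * (‖z‖ + 1) by ring, abs_mul,
                abs_of_nonneg (by positivity : 0 ≤ ‖z‖ + 1)]
            have h3 : ‖z‖ + 1 ≤ 3 := by
              have := norm_add_le (z - l) l
              rw [sub_add_cancel, hz, hl1] at this
              linarith [hr.trans_le (min_le_right _ _)]
            rw [h2, mul_right_comm]
            exact mul_le_mul (hbound z hzr) h3 (by positivity) hK0
        rw [hl1] at h1
        refine le_of_eq_of_le (congrArg _ ?_) h1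
        simp only [← smul_mul_assoc, ← add_mul]
        congr 1
        push_cast
        module
      have hl0 : starRingEnd ℂ l ≠ 0 := by
        rw [Ne, map_eq_zero]; rintro rfl; simp at hl1
      exact (smul_eq_zero.mp h0).resolve_left hl0
    · have hδ : 0 < |‖l‖ - 1| := abs_pos.mpr (sub_ne_zero.mpr hl1)
      -- Off the unit circle `R(z)Sⁿ` stays bounded near `l`, so its residue vanishes.
      have h0 : (1 + A * D) * S ^ n = 0 := by
        refine eq_zero_of_forall_small_norm_le _ 0 (min ρ (|‖l‖ - 1| / 2))
          (K / (|‖l‖ - 1| / 2)) (lt_min hρ (by positivity)) fun r h0 hr => ?_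
        have h1 := hest r (K / (|‖l‖ - 1| / 2)) h0 (hr.trans_le (min_le_left _ _)) 0 1 0
          fun z hz hzr => by
            rw [le_div_iff₀ (by positivity)]
            have h2 : |‖l‖ - 1| / 2 ≤ |‖z‖ - 1| := by
              have h3 := abs_sub_abs_le_abs_sub (‖l‖ - 1) (‖z‖ - 1)
              have h4 := abs_norm_sub_norm_le l z
              rw [sub_sub_sub_cancel_right] at h3
              rw [norm_sub_rev, hz] at h4
              linarith [hr.trans_le (min_le_right _ _)]
            refine le_trans ?_ (hbound z hzr)
            simp only [zero_mul, zero_add, add_zero, norm_one, one_mul]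
            rw [mul_comm]
            gcongr
        simpa using h1
      rw [mul_assoc, h0, mul_zero]
  rcases eq_or_ne l 0 with hl0 | hl0
  · have hSA : S = A := by rw [hA, hl0, zero_smul, sub_zero]
    refine ascent_eq_descent_of_pow_eq A (-D) hAD.neg_right (n + 1) ?_
    rw [hSA] at hAPS
    have hc : Commute (A * (1 + A * D)) (A ^ n) :=
      (((Commute.refl A).mul_left ((Commute.one_left A).add_left
        ((Commute.refl A).mul_left hAD.symm)))).pow_right n
    have h1 : A ^ (n + 1) + A ^ (n + 1 + 1) * D = 0 := by
      rw [← hAPS, hc.eq]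
      simp only [pow_succ, mul_add, mul_one, mul_assoc]
    rw [mul_neg, ← eq_neg_iff_add_eq_zero.mpr h1]
  -- Modulo `A`, `Sⁿ` is the invertible scalar `lⁿ`, so `APSⁿ = 0` puts `AP`, and hence `A = AP -
  -- A²D`, in `A²` times the commutant of `A`.
  · obtain ⟨B, hAB, hB⟩ : ∃ B : X →L[ℂ] X, Commute A B ∧ S ^ n = l ^ n • 1 + A * B := by
      refine ⟨∑ i ∈ Finset.range n, S ^ i * (l • 1) ^ (n - 1 - i), ?_, ?_⟩
      · exact Commute.sum_right _ _ _ fun i _ => (hAS.pow_right i).mul_right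
          (((Commute.one_right A).smul_right l).pow_right _)
      · have := ((Commute.one_right S).smul_right l).mul_geom_sum₂ n
        rw [this, smul_pow, one_pow, add_sub_cancel]
    have hAP : Commute A (1 + A * D) :=
      (Commute.one_right A).add_right ((Commute.refl A).mul_right hAD)
    refine ascent_eq_descent_of_pow_eq A (-((l ^ n)⁻¹ • ((1 + A * D) * B)) - D)
      (((hAP.mul_right hAB).smul_right _).neg_right.sub_right hAD) 1 ?_
    have hln : l ^ n ≠ 0 := pow_ne_zero n hl0
    have h1 : l ^ n • (A * (1 + A * D)) = -(A ^ 2 * ((1 + A * D) * B)) := by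
      rw [hB, mul_add, mul_smul_comm, mul_one, add_eq_zero_iff_eq_neg] at hAPS
      rw [hAPS, pow_two, mul_assoc, mul_assoc, ← mul_assoc _ A, ← hAP.eq, mul_assoc]
    have h2 : A * (1 + A * D) = (l ^ n)⁻¹ • -(A ^ 2 * ((1 + A * D) * B)) := by
      rw [← h1, inv_smul_smul₀ hln]
    have h3 : A = A * (1 + A * D) - A ^ 2 * D := by
      rw [mul_add, mul_one, pow_two, mul_assoc, add_sub_cancel_right]
    rw [pow_one, mul_sub, mul_neg, mul_smul_comm, ← smul_neg]
    change A = _ • -(A ^ 2 * _) - A ^ 2 * D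
    rw [← h2, ← h3]

end Polaroid

theorem theorem3p4 {H : Type*} [NormedAddCommGroup H] [InnerProductSpace ℂ H] [CompleteSpace H]
    (S T : H →L[ℂ] H) (m n : ℕ) (hm : 1 ≤ m) (hn : 1 ≤ n)
    (hS : PowerBounded S) (hT : PowerBounded T)
    (hcomm : S * adjoint T - adjoint T * S = 0)
    (hquasi : (adjoint S) ^ n * ((triangleOp T S) ^ m) (1 : H →L[ℂ] H) * S ^ n = 0) :
    IsPolaroid S := by
  obtain ⟨M, hM, hlow⟩ := norm_pow_le_norm_pow_mul_pow S T m n hS hT hcomm hquasi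
  exact isPolaroid_of_norm_pow_le S M n hM hlow
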